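/- **Theorem 1.** Let $U\subseteq\mathbb R^2$ be open, let $\alpha,\beta,\gamma,\delta,\epsilon,\varphi$ be smooth real functions of $(x,y)\in U$, and consider the third-order equation $$y'''-\alpha y'^5+\beta y'^4-\gamma y'^3+\delta y'^2-\epsilon y'+\varphi=0. \qquad (*)$$ Suppose that $c$ is a smooth nowhere vanishing function on $U$ with $c^2=\alpha/3$ (so $c=\pm\sqrt{\alpha}/\sqrt3$), put $$g=\frac{\beta-c_y}{5c},\qquad h=\frac{\gamma-2g^2-g_y+c_x}{4c},\qquad d=\frac{\delta-3gh-h_y+g_x}{3c},$$ and suppose that the consistency conditions $$\epsilon=2dg+h^2+d_y-h_x,\qquad \varphi=dh-d_x$$ hold on $U$. Suppose also that the Lie linearizability criteria for the second-order equation $y''+cy'^3-gy'^2+hy'-d=0$ hold on $U$ in one of their two forms: either $$3(ch)_x+3(cd)_y+3cd_y-2gg_x-gh_y-3c_{xx}-2g_{xy}-h_{yy}=0,$$ $$3(dg)_y+3(cd)_x+3dc_x-2hh_y-hg_x-3d_{yy}-2h_{xy}-g_{xx}=0,$$ or there are smooth functions $a,b,e,f$ on $U$ with $h=a-2e$, $g=f-2b$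 and $$3b_x+2g_x+h_y+3be-3cd=0,\qquad b_y-c_x+b^2+bg+ch+ce=0,$$ $$d_y-e_x-bd-dg-e^2-eh=0,\qquad 3e_y+2h_y+g_x+3be-3cd=0.$$ Then $(*)$ is linearizable on $U$ in the following sense: there is a cubically semi-linear second-order equation $y''+\tilde c\,y'^3-\tilde g\,y'^2+\tilde h\,y'-\tilde d=0$ with smooth coefficients on $U$ such that $(*)$ is obtained from it by differentiating with respect to $x$ and eliminating $y''$ by means of the second-order equation itself; and near every point of $U$ there is a point transformation $(x,y)\mapsto(u,v)$ (a smooth diffeomorphism onto its image) that turns this second-order equation into a linear equation $d^2v/du^2=A(u)\,dv/du+B(u)\,v+C(u)$ with smooth $A,B,C$ (at all $(x,y,y')$ with $du/dx\neq0$). -/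

import Mathlib

open scoped ContDiff

noncomputable section

namespace LieODE

/-- Partial derivative with respect to the first coordinate `x` of a function of `(x, y)`. -/
def px (F : ℝ × ℝ → ℝ) (z : ℝ × ℝ) : ℝ := fderiv ℝ F z (1, 0)

/-- Partial derivative with respect to the second coordinate `y` of a function of `(x, y)`. -/
def py (F : ℝ × ℝ → ℝ) (z : ℝ × ℝ) : ℝ := fderiv ℝ F z (0, 1)

/-- The right-hand side of the third-order equation
`y''' = α y'^5 - β y'^4 + γ y'^3 - δ y'^2 + ε y' - φ`, where `p` stands for `y'`. -/
def quinticRHS (α β γ δ ε φ : ℝ × ℝ → ℝ) (z : ℝ × ℝ) (p : ℝ) : ℝ :=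
  α z * p ^ 5 - β z * p ^ 4 + γ z * p ^ 3 - δ z * p ^ 2 + ε z * p - φ z

/-- The right-hand side of the cubically semi-linear second-order equation
`y'' + c y'^3 - g y'^2 + h y' - d = 0` solved for `y''`. -/
def cubicRHS (c g h d : ℝ × ℝ → ℝ) (z : ℝ × ℝ) (p : ℝ) : ℝ :=
  -(c z * p ^ 3) + g z * p ^ 2 - h z * p + d z

/-- Total `x`-derivative of `G (x, y, y')`, evaluated at `y' = p`, `y'' = q`. -/
def totalDeriv (G : ℝ × ℝ → ℝ → ℝ) (z : ℝ × ℝ) (p q : ℝ) : ℝ :=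
  px (fun w => G w p) z + p * py (fun w => G w p) z + q * deriv (G z) p

/-- `y''' = T (x, y, y')` is obtained by differentiating `y'' = G (x, y, y')` and eliminating
`y''` by means of the equation `y'' = G (x, y, y')` itself. -/
def ArisesByDifferentiating (U : Set (ℝ × ℝ)) (T G : ℝ × ℝ → ℝ → ℝ) : Prop :=
  ∀ z ∈ U, ∀ p : ℝ, T z p = totalDeriv G z p (G z p)

/-- First derivative of `x ↦ F (x, y x)`, in terms of `y' = p`. -/
def D1 (F : ℝ × ℝ → ℝ) (z : ℝ × ℝ) (p : ℝ) : ℝ := px F z + p * py F z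

/-- Second derivative of `x ↦ F (x, y x)`, in terms of `y' = p` and `y'' = q`. -/
def D2 (F : ℝ × ℝ → ℝ) (z : ℝ × ℝ) (p q : ℝ) : ℝ :=
  px (px F) z + 2 * p * px (py F) z + p ^ 2 * py (py F) z + q * py F z

/-- Jacobian determinant of `(x, y) ↦ (u, v)`. -/
def jac (u v : ℝ × ℝ → ℝ) (z : ℝ × ℝ) : ℝ := px u z * py v z - py u z * px v z

/-- The transformed first derivative `dv/du` along a curve with `y' = p`. -/
def newP (u v : ℝ × ℝ → ℝ) (z : ℝ × ℝ) (p : ℝ) : ℝ := D1 v z p / D1 u z p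

/-- The transformed second derivative `d²v/du²` along a curve with `y' = p`, `y'' = q`. -/
def newQ (u v : ℝ × ℝ → ℝ) (z : ℝ × ℝ) (p q : ℝ) : ℝ :=
  (D1 u z p * D2 v z p q - D1 v z p * D2 u z p q) / D1 u z p ^ 3

/-- A point transformation on the open set `V`: the smooth map `(x, y) ↦ (u, v)` is a
diffeomorphism of `V` onto its image. -/
structure IsPointTransformation (V : Set (ℝ × ℝ)) (u v : ℝ × ℝ → ℝ) : Prop where
  smooth_u : ContDiffOn ℝ ∞ u V
  smooth_v : ContDiffOn ℝ ∞ v V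
  injOn : Set.InjOn (fun z => (u z, v z)) V
  jac_ne_zero : ∀ z ∈ V, jac u v z ≠ 0

/-- `y'' = G (x, y, y')` is linearizable in the sense of Lie: near every point of `U` some
point transformation turns it into a linear equation
`d²v/du² = A (u) dv/du + B (u) v + C (u)`. The transformed derivatives make sense at those
`(x, y, y')` where `du/dx ≠ 0`. -/
def IsLieLinearizable (U : Set (ℝ × ℝ)) (G : ℝ × ℝ → ℝ → ℝ) : Prop :=
  ∀ z₀ ∈ U, ∃ V : Set (ℝ × ℝ), IsOpen V ∧ z₀ ∈ V ∧ V ⊆ U ∧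
    ∃ u v : ℝ × ℝ → ℝ, IsPointTransformation V u v ∧
      ∃ (J : Set ℝ) (A B C : ℝ → ℝ), IsOpen J ∧ Set.MapsTo u V J ∧
        ContDiffOn ℝ ∞ A J ∧ ContDiffOn ℝ ∞ B J ∧ ContDiffOn ℝ ∞ C J ∧
        ∀ z ∈ V, ∀ p : ℝ, D1 u z p ≠ 0 → ∀ q : ℝ,
          q = G z p ↔ newQ u v z p q = A (u z) * newP u v z p + B (u z) * v z + C (u z)

/-- The third-order equation `y''' = T (x, y, y')` is linearizable on `U`: it arises by
differentiating a cubically semi-linear second-order equation that is linearizable in the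
sense of Lie. -/
def IsLinearizable (U : Set (ℝ × ℝ)) (T : ℝ × ℝ → ℝ → ℝ) : Prop :=
  ∃ c g h d : ℝ × ℝ → ℝ,
    ContDiffOn ℝ ∞ c U ∧ ContDiffOn ℝ ∞ g U ∧ ContDiffOn ℝ ∞ h U ∧ ContDiffOn ℝ ∞ d U ∧
    ArisesByDifferentiating U T (cubicRHS c g h d) ∧
    IsLieLinearizable U (cubicRHS c g h d)

/-- The Lie criteria for `y'' + c y'^3 - g y'^2 + h y' - d = 0`, in terms of the four
coefficients. -/
def LieCriteria (U : Set (ℝ × ℝ)) (c g h d : ℝ × ℝ → ℝ) : Prop :=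
  ∀ z ∈ U,
    3 * px (fun w => c w * h w) z + 3 * py (fun w => c w * d w) z + 3 * c z * py d z
        - 2 * g z * px g z - g z * py h z
        - 3 * px (px c) z - 2 * px (py g) z - py (py h) z = 0 ∧
    3 * py (fun w => d w * g w) z + 3 * px (fun w => c w * d w) z + 3 * d z * px c z
        - 2 * h z * py h z - h z * px g z
        - 3 * py (py d) z - 2 * px (py h) z - px (px g) z = 0

/-- The Lie criteria for `y'' + c y'^3 - g y'^2 + h y' - d = 0`, in terms of auxiliary
functions `a, b, e, f` with `h = a - 2 e` and `g = f - 2 b`. -/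
def LieCriteriaAux (U : Set (ℝ × ℝ)) (c g h d : ℝ × ℝ → ℝ) : Prop :=
  ∃ a b e f : ℝ × ℝ → ℝ,
    ContDiffOn ℝ ∞ a U ∧ ContDiffOn ℝ ∞ b U ∧ ContDiffOn ℝ ∞ e U ∧ ContDiffOn ℝ ∞ f U ∧
    ∀ z ∈ U,
      h z = a z - 2 * e z ∧ g z = f z - 2 * b z ∧
      3 * px b z + 2 * px g z + py h z + 3 * b z * e z - 3 * c z * d z = 0 ∧
      py b z - px c z + b z ^ 2 + b z * g z + c z * h z + c z * e z = 0 ∧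
      py d z - px e z - b z * d z - d z * g z - e z ^ 2 - e z * h z = 0 ∧
      3 * py e z + 2 * py h z + px g z + 3 * b z * e z - 3 * c z * d z = 0

end LieODE

end

/-! Substituting y'' = G(x, y, y') into the derivative of this cubic equation gives a quintic in y'.
Comparing coefficients expresses α, ..., φ through c, g, h, d: the formulas for c², g, h, d solve
the first four relations in turn, and the consistency conditions are the last two
(`LieODE.arisesByDifferentiating_quinticRHS`).

The point transformation comes from a linear system expressing ψ_xx, ψ_xy, ψ_yy through ψ, ψ_x, ψ_y,
with first-order coefficients built from c, g, h, d. Along a solution curve of the cubic equation,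
every solution ψ of the system satisfies one and the same second-order linear ODE in x. Three
solutions therefore become linearly dependent there, and their ratios u = χ/ψ, v = ρ/ψ carry the
curve to a straight line, so that d²v/du² = 0. Four of the six compatibility conditions of the
system determine its zeroth-order coefficients; the other two are Lie's criteria. The auxiliary form
of the criteria reduces to the direct one by cross-differentiating b and e
(`LieODE.LieCriteriaAux.lieCriteria`).

A compatible system has local solutions with any initial jet by the linear Frobenius theorem
`exists_hasFDerivAt_linear_system`: solve in x along a horizontal line, then in y along vertical
lines. Compatibility and Grönwall's inequality show that the x-equation persists off the horizontal
line. -/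

/-! ### Linear ODEs and Grönwall estimates -/

section LinearODE

variable {E : Type*} [NormedAddCommGroup E] [NormedSpace ℝ E]

/-- A linear differential equation with bounded continuous coefficients is solvable, for every
initial value, on an interval whose length depends only on the bound of the coefficients. -/
theorem exists_hasDerivAt_linear_ode [CompleteSpace E] {A : ℝ → E →L[ℝ] E} {t₀ r K : ℝ}
    (hr : 0 < r) (hA : ContinuousOn A (Set.Icc (t₀ - r) (t₀ + r)))
    (hK : ∀ t ∈ Set.Icc (t₀ - r) (t₀ + r), ‖A t‖ ≤ K) (hKr : 2 * K * r ≤ 1) (w₀ : E) :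
    ∃ w : ℝ → E, w t₀ = w₀ ∧
      ∀ t ∈ Set.Ioo (t₀ - r) (t₀ + r), HasDerivAt w (A t (w t)) t := by
  have hmem : t₀ ∈ Set.Icc (t₀ - r) (t₀ + r) := ⟨by linarith, by linarith⟩
  have hK0 : 0 ≤ K := (norm_nonneg _).trans (hK t₀ hmem)
  have ha : 0 ≤ ‖w₀‖ := norm_nonneg w₀
  -- On the ball of radius ‖w₀‖ about w₀ the field is at most 2K‖w₀‖, so a solution stays in it for
  -- time r as 2Kr ≤ 1. Scaling the ball with w₀ makes r independent of w₀.
  have hpl : IsPicardLindelof (fun t w => A t w) ⟨t₀, hmem⟩ w₀ ⟨‖w₀‖, ha⟩ 0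
      ⟨K * (2 * ‖w₀‖), by positivity⟩ ⟨K, hK0⟩ := by
    refine ⟨fun t ht => ?_, fun w _ => hA.clm_apply continuousOn_const, fun t ht w hw => ?_, ?_⟩
    · refine LipschitzWith.lipschitzOnWith (LipschitzWith.of_dist_le_mul fun v w => ?_)
      rw [dist_eq_norm, dist_eq_norm, ← map_sub]
      exact (A t).le_of_opNorm_le (hK t ht) _
    · refine (A t).le_of_opNorm_le_of_le (hK t ht) ?_
      have h1 : dist w w₀ ≤ ‖w₀‖ := hw
      have h2 : ‖w‖ ≤ dist w w₀ + ‖w₀‖ := by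
        rw [dist_eq_norm]; simpa using norm_add_le (w - w₀) w₀
      linarith
    · change K * (2 * ‖w₀‖) * max (t₀ + r - t₀) (t₀ - (t₀ - r)) ≤ ‖w₀‖ - 0
      rw [show t₀ + r - t₀ = r by ring, show t₀ - (t₀ - r) = r by ring, max_self]
      nlinarith
  obtain ⟨w, hw0, hw⟩ := hpl.exists_eq_forall_mem_Icc_hasDerivWithinAt₀
  exact ⟨w, hw0, fun t ht => (hw t ⟨ht.1.le, ht.2.le⟩).hasDerivAt (Icc_mem_nhds ht.1 ht.2)⟩

/-- Grönwall's inequality on both sides of the initial time. -/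
theorem norm_le_gronwallBound_abs {f f' : ℝ → E} {δ K ε t₀ r : ℝ}
    (hf : ∀ t ∈ Set.Ioo (t₀ - r) (t₀ + r), HasDerivAt f (f' t) t) (h0 : ‖f t₀‖ ≤ δ)
    (hb : ∀ t ∈ Set.Ioo (t₀ - r) (t₀ + r), ‖f' t‖ ≤ K * ‖f t‖ + ε) {t : ℝ}
    (ht : t ∈ Set.Ioo (t₀ - r) (t₀ + r)) :
    ‖f t‖ ≤ gronwallBound δ K ε |t - t₀| := by
  rcases le_total t₀ t with h | h
  · rw [abs_of_nonneg (sub_nonneg.2 h)]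
    have hs : ∀ s ∈ Set.Icc t₀ t, s ∈ Set.Ioo (t₀ - r) (t₀ + r) := fun s hs =>
      ⟨by linarith [hs.1, hs.2, ht.2], by linarith [hs.2, ht.2]⟩
    exact norm_le_gronwallBound_of_norm_deriv_right_le
      (fun s hs' => (hf s (hs s hs')).continuousAt.continuousWithinAt)
      (fun s hs' => (hf s (hs s ⟨hs'.1, hs'.2.le⟩)).hasDerivWithinAt) h0
      (fun s hs' => hb s (hs s ⟨hs'.1, hs'.2.le⟩)) t ⟨h, le_rfl⟩
  · rw [abs_of_nonpos (sub_nonpos.2 h), neg_sub]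
    -- Backward times are handled by the reflection s ↦ t₀ - s.
    have hs : ∀ s ∈ Set.Icc 0 (t₀ - t), t₀ - s ∈ Set.Ioo (t₀ - r) (t₀ + r) := fun s hs =>
      ⟨by linarith [hs.2, ht.1], by linarith [hs.1, hs.2, ht.1]⟩
    have hd : ∀ s ∈ Set.Icc 0 (t₀ - t),
        HasDerivAt (fun s => f (t₀ - s)) (-f' (t₀ - s)) s := fun s hs' => by
      simpa [Function.comp_def] using (hf _ (hs s hs')).scomp s ((hasDerivAt_id s).const_sub t₀)
    have := norm_le_gronwallBound_of_norm_deriv_right_le (f := fun s => f (t₀ - s))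
      (f' := fun s => -f' (t₀ - s)) (δ := δ) (K := K) (ε := ε) (a := 0) (b := t₀ - t)
      (fun s hs' => (hd s hs').continuousAt.continuousWithinAt)
      (fun s hs' => (hd s ⟨hs'.1, hs'.2.le⟩).hasDerivWithinAt) (by simpa using h0)
      (fun s hs' => by simpa using hb _ (hs s ⟨hs'.1, hs'.2.le⟩)) (t₀ - t)
      ⟨by linarith, le_rfl⟩
    simpa using this

/-- Initial error and inhomogeneity have the same size e; K ≥ 1 absorbs the quotient e / K, which
leaves a bound linear in e. -/
theorem gronwallBound_self_le {K e t r : ℝ} (hK : 1 ≤ K) (he : 0 ≤ e) (ht : t ≤ r) :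
    gronwallBound e K e t ≤ 2 * e * Real.exp (K * r) := by
  have hK0 : K ≠ 0 := by linarith
  rw [gronwallBound_of_K_ne_0 hK0]
  have h1 : Real.exp (K * t) ≤ Real.exp (K * r) := Real.exp_le_exp.2 (by nlinarith)
  have h2 : e / K ≤ e := div_le_self he hK
  have h3 : 0 ≤ e / K := div_nonneg he (by linarith)
  have h4 := Real.exp_pos (K * t)
  have h5 := Real.exp_pos (K * r)
  have h6 : e / K * (Real.exp (K * t) - 1) ≤ e * Real.exp (K * r) := by
    calc e / K * (Real.exp (K * t) - 1) ≤ e / K * Real.exp (K * r) := by gcongr; linarith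
      _ ≤ e * Real.exp (K * r) := by gcongr
  nlinarith [mul_le_mul_of_nonneg_left h1 he]

/-- Second-order Taylor estimate for a function whose derivative is Lipschitz. -/
theorem norm_sub_sub_smul_le {f f' : ℝ → E} {s : Set ℝ} {C x₁ x₂ : ℝ} (hs : Convex ℝ s)
    (hf : ∀ x ∈ s, HasDerivAt f (f' x) x) (hC : 0 ≤ C)
    (hf' : ∀ x ∈ s, ∀ y ∈ s, ‖f' x - f' y‖ ≤ C * |x - y|) (h₁ : x₁ ∈ s) (h₂ : x₂ ∈ s) :
    ‖f x₂ - f x₁ - (x₂ - x₁) • f' x₁‖ ≤ C * |x₂ - x₁| * |x₂ - x₁| := by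
  have hseg : Set.uIcc x₁ x₂ ⊆ s := by
    rw [← segment_eq_uIcc]; exact hs.segment_subset h₁ h₂
  have hd : ∀ x ∈ Set.uIcc x₁ x₂, HasDerivWithinAt (fun x => f x - x • f' x₁)
      (f' x - f' x₁) (Set.uIcc x₁ x₂) x := fun x hx => by
    simpa using ((hf x (hseg hx)).fun_sub ((hasDerivAt_id x).smul_const (f' x₁))).hasDerivWithinAt
  have hbound : ∀ x ∈ Set.uIcc x₁ x₂, ‖f' x - f' x₁‖ ≤ C * |x₂ - x₁| := fun x hx =>
    (hf' x (hseg hx) x₁ h₁).trans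
      (mul_le_mul_of_nonneg_left (Set.abs_sub_left_of_mem_uIcc hx) hC)
  have := Convex.norm_image_sub_le_of_norm_hasDerivWithin_le hd hbound (convex_uIcc x₁ x₂)
    Set.left_mem_uIcc Set.right_mem_uIcc
  rw [Real.norm_eq_abs] at this
  convert this using 2
  rw [sub_smul]; abel

end LinearODE

/-! ### Frobenius' theorem for linear systems in the plane -/

section Frobenius

open Filter Topology

variable {E : Type*} [NormedAddCommGroup E] [NormedSpace ℝ E]

/-- A family of solutions of `∂Ψ/∂y = NΨ` which satisfies `∂Ψ/∂x = MΨ` on the line `y = y₀` is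
differentiable in `x`, with `∂Ψ/∂x = MΨ`, uniformly in `y`. -/
theorem eventually_norm_sub_sub_smul_le {M N Nx My : ℝ × ℝ → E →L[ℝ] E} {x₀ y₀ r K C : ℝ}
    {I J : Set ℝ} (hI : I = Set.Ioo (x₀ - r) (x₀ + r)) (hJ : J = Set.Ioo (y₀ - r) (y₀ + r))
    (hr : 0 < r) (hK : 1 ≤ K) (hC : 0 ≤ C)
    (hNx : ∀ x ∈ I, ∀ y ∈ J, HasDerivAt (fun x => N (x, y)) (Nx (x, y)) x)
    (hMy : ∀ x ∈ I, ∀ y ∈ J, HasDerivAt (fun y => M (x, y)) (My (x, y)) y)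
    (hMK : ∀ x ∈ I, ∀ y ∈ J, ‖M (x, y)‖ ≤ K) (hNK : ∀ x ∈ I, ∀ y ∈ J, ‖N (x, y)‖ ≤ K)
    (hNC : ∀ x ∈ I, ∀ x' ∈ I, ∀ y ∈ J, ‖N (x', y) - N (x, y)‖ ≤ C * |x' - x|)
    (hNxC : ∀ x ∈ I, ∀ x' ∈ I, ∀ y ∈ J, ‖Nx (x', y) - Nx (x, y)‖ ≤ C * |x' - x|)
    (hcompat : ∀ x ∈ I, ∀ y ∈ J,
      My (x, y) + M (x, y) ∘L N (x, y) = Nx (x, y) + N (x, y) ∘L M (x, y))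
    {Ψ : ℝ → ℝ → E}
    (hbase : ∀ x ∈ I, HasDerivAt (fun x => Ψ x y₀) (M (x, y₀) (Ψ x y₀)) x)
    (hΨ : ∀ x ∈ I, ∀ y ∈ J, HasDerivAt (Ψ x) (N (x, y) (Ψ x y)) y)
    {x : ℝ} (hx : x ∈ I) {η : ℝ} (hη : 0 < η) :
    ∀ᶠ x' in 𝓝 x, ∀ y ∈ J,
      ‖Ψ x' y - Ψ x y - (x' - x) • M (x, y) (Ψ x y)‖ ≤ η * |x' - x| := by
  have hy₀ : y₀ ∈ J := by rw [hJ]; constructor <;> linarith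
  have hIo : IsOpen I := by rw [hI]; exact isOpen_Ioo
  have hIc : Convex ℝ I := by rw [hI]; exact convex_Ioo _ _
  obtain ⟨B, hB0, hB⟩ : ∃ B, 0 ≤ B ∧ ∀ y ∈ J, ‖Ψ x y‖ ≤ B := by
    refine ⟨‖Ψ x y₀‖ * Real.exp (K * r), by positivity, fun y hy => ?_⟩
    subst hJ
    refine (norm_le_gronwallBound_abs (δ := ‖Ψ x y₀‖) (K := K) (ε := 0)
      (fun t ht => hΨ x hx t ht) le_rfl (fun t ht => ?_) hy).trans ?_
    · rw [add_zero]; exact (N (x, t)).le_of_opNorm_le (hNK x hx t ht) _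
    · rw [gronwallBound_ε0]
      have : |y - y₀| ≤ r := abs_le.2 ⟨by linarith [hy.1], by linarith [hy.2]⟩
      gcongr
  -- Chosen so that the final Grönwall bound 2 e exp(Kr) |x' - x| equals η |x' - x|.
  set e : ℝ := η / (2 * Real.exp (K * r)) with he
  have he0 : 0 < e := by positivity
  have hev1 : ∀ᶠ x' in 𝓝 x, ‖Ψ x' y₀ - Ψ x y₀ - (x' - x) • M (x, y₀) (Ψ x y₀)‖ ≤
      e * |x' - x| := by
    have := (hasDerivAt_iff_isLittleO.1 (hbase x hx)).bound he0
    simpa only [Real.norm_eq_abs] using this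
  have hev2 : ∀ᶠ x' in 𝓝 x, C * B * (1 + K) * |x' - x| ≤ e := by
    have : Tendsto (fun x' => C * B * (1 + K) * |x' - x|) (𝓝 x) (𝓝 (C * B * (1 + K) * |x - x|)) :=
      (by fun_prop : Continuous fun x' => C * B * (1 + K) * |x' - x|).tendsto x
    rw [sub_self, abs_zero, mul_zero] at this
    exact (this.eventually (gt_mem_nhds he0)).mono fun _ h => le_of_lt h
  filter_upwards [hev1, hev2, hIo.mem_nhds hx] with x' h1 h2 hx' y hy
  have hder : ∀ t ∈ J, HasDerivAt (fun t => Ψ x' t - Ψ x t - (x' - x) • M (x, t) (Ψ x t))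
      (N (x', t) (Ψ x' t) - N (x, t) (Ψ x t) -
        (x' - x) • (My (x, t) (Ψ x t) + M (x, t) (N (x, t) (Ψ x t)))) t := fun t ht =>
    ((hΨ x' hx' t ht).fun_sub (hΨ x hx t ht)).fun_sub
      (((hMy x hx t ht).clm_apply (hΨ x hx t ht)).const_smul (x' - x))
  have hbd : ∀ t ∈ J, ‖N (x', t) (Ψ x' t) - N (x, t) (Ψ x t) -
        (x' - x) • (My (x, t) (Ψ x t) + M (x, t) (N (x, t) (Ψ x t)))‖ ≤
      K * ‖Ψ x' t - Ψ x t - (x' - x) • M (x, t) (Ψ x t)‖ + e * |x' - x| := by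
    intro t ht
    have hc : My (x, t) (Ψ x t) + M (x, t) (N (x, t) (Ψ x t)) =
        Nx (x, t) (Ψ x t) + N (x, t) (M (x, t) (Ψ x t)) := by
      simpa using congrArg (fun L => L (Ψ x t)) (hcompat x hx t ht)
    -- By compatibility the remainder itself solves the y-equation at x', up to an error quadratic
    -- in x' - x: a Taylor remainder of N, and a difference of N multiplied by x' - x.
    have hsplit : N (x', t) (Ψ x' t) - N (x, t) (Ψ x t) -
        (x' - x) • (My (x, t) (Ψ x t) + M (x, t) (N (x, t) (Ψ x t))) =
        N (x', t) (Ψ x' t - Ψ x t - (x' - x) • M (x, t) (Ψ x t)) +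
        ((N (x', t) - N (x, t) - (x' - x) • Nx (x, t)) (Ψ x t) +
          (x' - x) • (N (x', t) - N (x, t)) (M (x, t) (Ψ x t))) := by
      rw [hc]
      simp only [map_sub, map_smul, sub_apply, smul_apply, smul_add, smul_sub]
      abel
    rw [hsplit]
    have hT : ‖N (x', t) - N (x, t) - (x' - x) • Nx (x, t)‖ ≤ C * |x' - x| * |x' - x| :=
      norm_sub_sub_smul_le hIc (fun s hs => hNx s hs t ht) hC
        (fun s hs s' hs' => hNxC s' hs' s hs t ht) hx hx'
    have e1 : ‖(N (x', t) - N (x, t) - (x' - x) • Nx (x, t)) (Ψ x t)‖ ≤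
        C * |x' - x| * |x' - x| * B :=
      ContinuousLinearMap.le_of_opNorm_le_of_le _ hT (hB t ht)
    have e2 : ‖(x' - x) • (N (x', t) - N (x, t)) (M (x, t) (Ψ x t))‖ ≤
        |x' - x| * (C * |x' - x| * (K * B)) := by
      rw [norm_smul, Real.norm_eq_abs]
      gcongr
      exact ContinuousLinearMap.le_of_opNorm_le_of_le _ (hNC x hx x' hx' t ht)
        (ContinuousLinearMap.le_of_opNorm_le_of_le _ (hMK x hx t ht) (hB t ht))
    have e3 : C * |x' - x| * |x' - x| * B + |x' - x| * (C * |x' - x| * (K * B)) ≤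
        e * |x' - x| := by
      have := mul_le_mul_of_nonneg_right h2 (abs_nonneg (x' - x))
      nlinarith
    exact (norm_add_le _ _).trans (add_le_add ((N (x', t)).le_of_opNorm_le (hNK x' hx' t ht) _)
      ((norm_add_le _ _).trans ((add_le_add e1 e2).trans e3)))
  subst hJ
  refine (norm_le_gronwallBound_abs hder h1 hbd hy).trans
    ((gronwallBound_self_le hK (by positivity)
      (abs_le.2 ⟨by linarith [hy.1], by linarith [hy.2]⟩ : |y - y₀| ≤ r)).trans (le_of_eq ?_))
  rw [he]
  field_simp

/-- A smooth function on an open subset of the plane has bounded derivative on compact sets. -/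
theorem exists_bound_fderiv_of_isCompact {F : Type*} [NormedAddCommGroup F] [NormedSpace ℝ F]
    {U S : Set (ℝ × ℝ)} (hU : IsOpen U) (hS : IsCompact S) (hSU : S ⊆ U) {f : ℝ × ℝ → F}
    (hf : ContDiffOn ℝ ∞ f U) : ∃ C, ∀ z ∈ S, ‖fderiv ℝ f z‖ ≤ C :=
  hS.exists_bound_of_continuousOn ((hf.continuousOn_fderiv_of_isOpen hU (by simp)).mono hSU)

/-- **Frobenius' theorem** for linear systems `∂Ψ/∂x = MΨ`, `∂Ψ/∂y = NΨ` in the plane. -/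
theorem exists_hasFDerivAt_linear_system [CompleteSpace E] {U : Set (ℝ × ℝ)} (hU : IsOpen U)
    {M N : ℝ × ℝ → E →L[ℝ] E} (hM : ContDiffOn ℝ ∞ M U) (hN : ContDiffOn ℝ ∞ N U)
    (hcompat : ∀ z ∈ U, fderiv ℝ M z (0, 1) + M z ∘L N z = fderiv ℝ N z (1, 0) + N z ∘L M z)
    {z₀ : ℝ × ℝ} (hz₀ : z₀ ∈ U) :
    ∃ V : Set (ℝ × ℝ), IsOpen V ∧ z₀ ∈ V ∧ V ⊆ U ∧ ∀ w₀ : E, ∃ Ψ : ℝ × ℝ → E, Ψ z₀ = w₀ ∧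
      ∀ z ∈ V, HasFDerivAt Ψ ((ContinuousLinearMap.toSpanSingleton ℝ (M z (Ψ z))).coprod
        (ContinuousLinearMap.toSpanSingleton ℝ (N z (Ψ z)))) z := by
  obtain ⟨x₀, y₀⟩ := z₀
  obtain ⟨R, hR0, hR⟩ := Metric.nhds_basis_closedBall.mem_iff.1 (hU.mem_nhds hz₀)
  have hcpt : IsCompact (Metric.closedBall (x₀, y₀) R) := isCompact_closedBall _ _
  have hN1 : ContDiffOn ℝ ∞ (fun z => fderiv ℝ N z (1, 0)) U :=
    (hN.fderiv_of_isOpen hU (by simp)).clm_apply contDiffOn_const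
  obtain ⟨K₁, hK₁⟩ := hcpt.exists_bound_of_continuousOn (hM.continuousOn.mono hR)
  obtain ⟨K₂, hK₂⟩ := hcpt.exists_bound_of_continuousOn (hN.continuousOn.mono hR)
  obtain ⟨C₁, hC₁⟩ := exists_bound_fderiv_of_isCompact hU hcpt hR hN
  obtain ⟨C₂, hC₂⟩ := exists_bound_fderiv_of_isCompact hU hcpt hR hN1
  set K : ℝ := max 1 (max K₁ K₂)
  set C : ℝ := max 0 (max C₁ C₂)
  have hK1 : 1 ≤ K := le_max_left _ _
  have hC0 : 0 ≤ C := le_max_left _ _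
  have hK₁' : K₁ ≤ K := (le_max_left _ _).trans (le_max_right _ _)
  have hK₂' : K₂ ≤ K := (le_max_right _ _).trans (le_max_right _ _)
  have hC₁' : C₁ ≤ C := (le_max_left _ _).trans (le_max_right _ _)
  have hC₂' : C₂ ≤ C := (le_max_right _ _).trans (le_max_right _ _)
  set r : ℝ := min R (1 / (2 * K))
  have hr0 : 0 < r := lt_min hR0 (by positivity)
  have hrR : r ≤ R := min_le_left _ _
  have hKr : 2 * K * r ≤ 1 := by
    have : r ≤ 1 / (2 * K) := min_le_right _ _
    rw [le_div_iff₀ (by positivity)] at this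
    linarith
  obtain ⟨I, hI⟩ : ∃ I, I = Set.Ioo (x₀ - r) (x₀ + r) := ⟨_, rfl⟩
  obtain ⟨J, hJ⟩ : ∃ J, J = Set.Ioo (y₀ - r) (y₀ + r) := ⟨_, rfl⟩
  have hIo : IsOpen I := by rw [hI]; exact isOpen_Ioo
  have hJo : IsOpen J := by rw [hJ]; exact isOpen_Ioo
  have hx₀ : x₀ ∈ I := by rw [hI]; constructor <;> linarith
  have hy₀ : y₀ ∈ J := by rw [hJ]; constructor <;> linarith
  have hcb : ∀ x ∈ Set.Icc (x₀ - r) (x₀ + r), ∀ y ∈ Set.Icc (y₀ - r) (y₀ + r),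
      (x, y) ∈ Metric.closedBall (x₀, y₀) R := by
    intro x hx y hy
    rw [← Real.closedBall_eq_Icc] at hx hy
    rw [← closedBall_prod_same]
    exact ⟨Metric.closedBall_subset_closedBall hrR hx, Metric.closedBall_subset_closedBall hrR hy⟩
  have hIJ : ∀ x ∈ I, ∀ y ∈ J, (x, y) ∈ Metric.closedBall (x₀, y₀) R := by
    rw [hI, hJ]
    exact fun x hx y hy => hcb x (Set.Ioo_subset_Icc_self hx) y (Set.Ioo_subset_Icc_self hy)
  have hslice1 : ∀ x y : ℝ, HasDerivAt (fun x : ℝ => (x, y)) ((1, 0) : ℝ × ℝ) x := fun x y =>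
    (hasDerivAt_id x).prodMk (hasDerivAt_const x y)
  have hslice2 : ∀ x y : ℝ, HasDerivAt (fun y : ℝ => (x, y)) ((0, 1) : ℝ × ℝ) y := fun x y =>
    (hasDerivAt_const y x).prodMk (hasDerivAt_id y)
  have hdiff : ∀ {F : Type _} [NormedAddCommGroup F] [NormedSpace ℝ F] {f : ℝ × ℝ → F},
      ContDiffOn ℝ ∞ f U → ∀ z ∈ U, DifferentiableAt ℝ f z := fun hf z hz =>
    (hf.contDiffAt (hU.mem_nhds hz)).differentiableAt (by simp)
  have hlip : ∀ {F : Type _} [NormedAddCommGroup F] [NormedSpace ℝ F] {f : ℝ × ℝ → F},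
      ContDiffOn ℝ ∞ f U → (∀ z ∈ Metric.closedBall (x₀, y₀) R, ‖fderiv ℝ f z‖ ≤ C) →
      ∀ x ∈ I, ∀ x' ∈ I, ∀ y ∈ J, ‖f (x', y) - f (x, y)‖ ≤ C * |x' - x| := by
    intro F _ _ f hf hb x hx x' hx' y hy
    have := (convex_closedBall (x₀, y₀) R).norm_image_sub_le_of_norm_fderiv_le
      (fun z hz => hdiff hf z (hR hz)) hb (hIJ x hx y hy) (hIJ x' hx' y hy)
    simpa [Prod.norm_def] using this
  have hcontIcc : ContinuousOn (fun x => M (x, y₀)) (Set.Icc (x₀ - r) (x₀ + r)) :=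
    (hM.continuousOn.mono hR).comp (by fun_prop)
      fun x hx => hcb x hx y₀ ⟨by linarith, by linarith⟩
  refine ⟨I ×ˢ J, hIo.prod hJo, ⟨hx₀, hy₀⟩, fun z hz => hR (hIJ z.1 hz.1 z.2 hz.2), fun w₀ => ?_⟩
  obtain ⟨b, hb0, hb⟩ := exists_hasDerivAt_linear_ode hr0 hcontIcc
    (fun x hx => (hK₁ _ (hcb x hx y₀ ⟨by linarith, by linarith⟩)).trans hK₁') hKr w₀
  -- All vertical solutions live on the same J, because the existence time does not depend on the
  -- initial value b x. Outside I the value is a dummy.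
  have hex : ∀ x, ∃ w : ℝ → E, x ∈ I → w y₀ = b x ∧ ∀ y ∈ J, HasDerivAt w (N (x, y) (w y)) y := by
    intro x
    by_cases hx : x ∈ I
    · have hx' : x ∈ Set.Icc (x₀ - r) (x₀ + r) := by
        rw [hI] at hx; exact Set.Ioo_subset_Icc_self hx
      obtain ⟨w, hw0, hw⟩ := exists_hasDerivAt_linear_ode hr0
        ((hN.continuousOn.mono hR).comp (by fun_prop) fun y hy => hcb x hx' y hy)
        (fun y hy => (hK₂ _ (hcb x hx' y hy)).trans hK₂') hKr (b x)
      exact ⟨w, fun _ => ⟨hw0, hJ ▸ hw⟩⟩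
    · exact ⟨0, fun h => (hx h).elim⟩
  choose Ψ hΨ using hex
  have hbase : ∀ x ∈ I, HasDerivAt (fun x => Ψ x y₀) (M (x, y₀) (Ψ x y₀)) x := by
    intro x hx
    rw [(hΨ x hx).1]
    refine (hb x (hI ▸ hx)).congr_of_eventuallyEq ?_
    filter_upwards [hIo.mem_nhds hx] with x' hx' using (hΨ x' hx').1
  have huniform := fun {x : ℝ} (hx : x ∈ I) {η : ℝ} (hη : 0 < η) =>
    eventually_norm_sub_sub_smul_le (M := M) (N := N) (Nx := fun z => fderiv ℝ N z (1, 0))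
      (My := fun z => fderiv ℝ M z (0, 1)) hI hJ hr0 hK1 hC0
      (fun x hx y hy => (hdiff hN _ (hR (hIJ x hx y hy))).hasFDerivAt.comp_hasDerivAt x
        (hslice1 x y))
      (fun x hx y hy => (hdiff hM _ (hR (hIJ x hx y hy))).hasFDerivAt.comp_hasDerivAt y
        (hslice2 x y))
      (fun x hx y hy => (hK₁ _ (hIJ x hx y hy)).trans hK₁')
      (fun x hx y hy => (hK₂ _ (hIJ x hx y hy)).trans hK₂')
      (hlip hN fun z hz => (hC₁ z hz).trans hC₁')
      (hlip hN1 fun z hz => (hC₂ z hz).trans hC₂')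
      (fun x hx y hy => hcompat _ (hR (hIJ x hx y hy))) hbase (fun x hx => (hΨ x hx).2) hx hη
  have hΨx : ∀ x ∈ I, ∀ y ∈ J, HasDerivAt (fun x => Ψ x y) (M (x, y) (Ψ x y)) x := by
    intro x hx y hy
    rw [hasDerivAt_iff_isLittleO, Asymptotics.isLittleO_iff]
    intro η hη
    filter_upwards [huniform hx hη] with x' hx' using hx' y hy
  -- Uniformity in y of the x-expansion (with η = 1) gives joint continuity. The partial derivatives
  -- MΨ and NΨ are then continuous, which upgrades them to a total derivative.
  have hcont : ∀ x ∈ I, ∀ y ∈ J, ContinuousAt (fun z : ℝ × ℝ => Ψ z.1 z.2) (x, y) := by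
    intro x hx y hy
    have hΨc : ContinuousAt (Ψ x) y := ((hΨ x hx).2 y hy).continuousAt
    have hMc : ContinuousAt (fun t => M (x, t)) y :=
      ((hdiff hM _ (hR (hIJ x hx y hy))).hasFDerivAt.comp_hasDerivAt y (hslice2 x y)).continuousAt
    have hlim : Tendsto (fun z : ℝ × ℝ => Ψ x z.2 + (z.1 - x) • M (x, z.2) (Ψ x z.2))
        (𝓝 (x, y)) (𝓝 (Ψ x y + (x - x) • M (x, y) (Ψ x y))) := by
      have h2 : Tendsto (fun z : ℝ × ℝ => z.2) (𝓝 (x, y)) (𝓝 y) := continuous_snd.tendsto _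
      have h1 : Tendsto (fun z : ℝ × ℝ => z.1) (𝓝 (x, y)) (𝓝 x) := continuous_fst.tendsto _
      exact (hΨc.tendsto.comp h2).add ((h1.sub_const x).smul
        ((hMc.clm_apply hΨc).tendsto.comp h2))
    rw [sub_self, zero_smul, add_zero] at hlim
    have hrem : Tendsto (fun z : ℝ × ℝ =>
        Ψ z.1 z.2 - (Ψ x z.2 + (z.1 - x) • M (x, z.2) (Ψ x z.2))) (𝓝 (x, y)) (𝓝 0) := by
      have hz : Tendsto (fun z : ℝ × ℝ => 1 * |z.1 - x|) (𝓝 (x, y)) (𝓝 0) := by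
        have : Continuous fun z : ℝ × ℝ => 1 * |z.1 - x| := by fun_prop
        simpa using this.tendsto (x, y)
      refine squeeze_zero_norm' ?_ hz
      have hev : ∀ᶠ z : ℝ × ℝ in 𝓝 (x, y), (∀ t ∈ J, ‖Ψ z.1 t - Ψ x t - (z.1 - x) •
          M (x, t) (Ψ x t)‖ ≤ 1 * |z.1 - x|) :=
        (continuous_fst.tendsto (x, y)).eventually (huniform hx one_pos)
      have hev2 : ∀ᶠ z : ℝ × ℝ in 𝓝 (x, y), z.2 ∈ J :=
        (continuous_snd.tendsto (x, y)).eventually (hJo.mem_nhds hy)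
      filter_upwards [hev, hev2] with z hz1 hz2
      rw [← sub_sub]
      exact hz1 z.2 hz2
    have := hrem.add hlim
    simp only [sub_add_cancel, zero_add] at this
    exact this
  refine ⟨fun z => Ψ z.1 z.2, by rw [← hb0]; exact (hΨ x₀ hx₀).1, ?_⟩
  rintro ⟨x, y⟩ ⟨hx, hy⟩
  have hnhds : ∀ᶠ z in 𝓝 (x, y), z ∈ I ×ˢ J := (hIo.prod hJo).mem_nhds ⟨hx, hy⟩
  have hL : Continuous fun w : E => ContinuousLinearMap.toSpanSingleton ℝ w :=
    (ContinuousLinearMap.toSpanSingletonCLE (𝕜 := ℝ) (E := E)).continuous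
  have key := hasStrictFDerivAt_uncurry_coprod (𝕜 := ℝ) (u := (x, y)) (f := Ψ)
    (f₁ := fun x y => ContinuousLinearMap.toSpanSingleton ℝ (M (x, y) (Ψ x y)))
    (f₂ := fun x y => ContinuousLinearMap.toSpanSingleton ℝ (N (x, y) (Ψ x y)))
    (by filter_upwards [hnhds] with z hz using (hΨx z.1 hz.1 z.2 hz.2).hasFDerivAt)
    (by filter_upwards [hnhds] with z hz using ((hΨ z.1 hz.1).2 z.2 hz.2).hasFDerivAt)
    (hL.continuousAt.comp (((hdiff hM _ (hR (hIJ x hx y hy))).continuousAt).clm_apply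
      (hcont x hx y hy)))
    (hL.continuousAt.comp (((hdiff hN _ (hR (hIJ x hx y hy))).continuousAt).clm_apply
      (hcont x hx y hy)))
  exact key.hasFDerivAt

/-- Differentiable solutions of a linear system with smooth coefficients are smooth. -/
theorem contDiffOn_of_hasFDerivAt_linear_system {V : Set (ℝ × ℝ)} (hV : IsOpen V)
    {M N : ℝ × ℝ → E →L[ℝ] E} (hM : ContDiffOn ℝ ∞ M V) (hN : ContDiffOn ℝ ∞ N V)
    {Ψ : ℝ × ℝ → E}
    (hΨ : ∀ z ∈ V, HasFDerivAt Ψ ((ContinuousLinearMap.toSpanSingleton ℝ (M z (Ψ z))).coprod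
        (ContinuousLinearMap.toSpanSingleton ℝ (N z (Ψ z)))) z) :
    ContDiffOn ℝ ∞ Ψ V := by
  rw [contDiffOn_infty]
  intro n
  have hdiff : DifferentiableOn ℝ Ψ V := fun z hz =>
    (hΨ z hz).differentiableAt.differentiableWithinAt
  induction n with
  | zero => exact contDiffOn_zero.2 hdiff.continuousOn
  | succ n ih =>
    rw [Nat.cast_succ, contDiffOn_succ_iff_fderiv_of_isOpen hV]
    refine ⟨hdiff, by simp, ?_⟩
    -- Bootstrapping: the derivative is built from M, N and Ψ itself, so it is as smooth as Ψ is
    -- already known to be.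
    refine ContDiffOn.congr (f := fun z =>
      (ContinuousLinearMap.toSpanSingleton ℝ (M z (Ψ z))).coprod
        (ContinuousLinearMap.toSpanSingleton ℝ (N z (Ψ z)))) ?_ fun z hz => (hΨ z hz).fderiv
    have hL : ContDiff ℝ n fun w : E => ContinuousLinearMap.toSpanSingleton ℝ w :=
      (ContinuousLinearMap.toSpanSingletonCLE (𝕜 := ℝ) (E := E)).contDiff
    have hMn : ContDiffOn ℝ n M V := contDiffOn_infty.1 hM n
    have hNn : ContDiffOn ℝ n N V := contDiffOn_infty.1 hN n
    have h1 := hL.comp_contDiffOn (hMn.clm_apply ih)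
    have h2 := hL.comp_contDiffOn (hNn.clm_apply ih)
    refine ((h1.clm_comp (contDiffOn_const (c := ContinuousLinearMap.fst ℝ ℝ ℝ))).add
      (h2.clm_comp (contDiffOn_const (c := ContinuousLinearMap.snd ℝ ℝ ℝ)))).congr fun z _ => ?_
    ext <;> simp

end Frobenius

namespace LieODE

/-! ### Calculus of partial derivatives -/

section PartialDerivatives

variable {f g : ℝ × ℝ → ℝ} {z : ℝ × ℝ} {U : Set (ℝ × ℝ)}

theorem px_const (k : ℝ) : px (fun _ => k) z = 0 := by simp [px]

theorem py_const (k : ℝ) : py (fun _ => k) z = 0 := by simp [py]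

theorem px_add (hf : DifferentiableAt ℝ f z) (hg : DifferentiableAt ℝ g z) :
    px (fun w => f w + g w) z = px f z + px g z := by
  simp [px, fderiv_fun_add hf hg]

theorem py_add (hf : DifferentiableAt ℝ f z) (hg : DifferentiableAt ℝ g z) :
    py (fun w => f w + g w) z = py f z + py g z := by
  simp [py, fderiv_fun_add hf hg]

theorem px_sub (hf : DifferentiableAt ℝ f z) (hg : DifferentiableAt ℝ g z) :
    px (fun w => f w - g w) z = px f z - px g z := by
  simp [px, fderiv_fun_sub hf hg]

theorem py_sub (hf : DifferentiableAt ℝ f z) (hg : DifferentiableAt ℝ g z) :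
    py (fun w => f w - g w) z = py f z - py g z := by
  simp [py, fderiv_fun_sub hf hg]

theorem px_mul (hf : DifferentiableAt ℝ f z) (hg : DifferentiableAt ℝ g z) :
    px (fun w => f w * g w) z = px f z * g z + f z * px g z := by
  simp [px, fderiv_fun_mul hf hg]; ring

theorem py_mul (hf : DifferentiableAt ℝ f z) (hg : DifferentiableAt ℝ g z) :
    py (fun w => f w * g w) z = py f z * g z + f z * py g z := by
  simp [py, fderiv_fun_mul hf hg]; ring

theorem px_neg : px (fun w => -f w) z = -px f z := by
  simp [px, fderiv_fun_neg]

theorem py_neg : py (fun w => -f w) z = -py f z := by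
  simp [py, fderiv_fun_neg]

theorem px_congr (hU : IsOpen U) (h : Set.EqOn f g U) (hz : z ∈ U) : px f z = px g z := by
  rw [px, px, (h.eventuallyEq_of_mem (hU.mem_nhds hz)).fderiv_eq]

theorem py_congr (hU : IsOpen U) (h : Set.EqOn f g U) (hz : z ∈ U) : py f z = py g z := by
  rw [py, py, (h.eventuallyEq_of_mem (hU.mem_nhds hz)).fderiv_eq]

theorem contDiffOn_px (hU : IsOpen U) (hf : ContDiffOn ℝ ∞ f U) : ContDiffOn ℝ ∞ (px f) U :=
  (hf.fderiv_of_isOpen hU (by simp)).clm_apply contDiffOn_const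

theorem contDiffOn_py (hU : IsOpen U) (hf : ContDiffOn ℝ ∞ f U) : ContDiffOn ℝ ∞ (py f) U :=
  (hf.fderiv_of_isOpen hU (by simp)).clm_apply contDiffOn_const

theorem differentiableAt_of_contDiffOn (hU : IsOpen U) (hf : ContDiffOn ℝ ∞ f U) (hz : z ∈ U) :
    DifferentiableAt ℝ f z :=
  (hf.contDiffAt (hU.mem_nhds hz)).differentiableAt (by simp)

theorem px_py_comm (hU : IsOpen U) (hf : ContDiffOn ℝ ∞ f U) (hz : z ∈ U) :
    px (py f) z = py (px f) z := by
  have hf' : DifferentiableAt ℝ (fderiv ℝ f) z :=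
    ((hf.fderiv_of_isOpen hU (m := ∞) (by simp)).contDiffAt (hU.mem_nhds hz)).differentiableAt
      (by simp)
  have hsymm := (hf.contDiffAt (hU.mem_nhds hz)).isSymmSndFDerivAt
    (by rw [minSmoothness_of_isRCLikeNormedField]; exact WithTop.coe_le_coe.2 (le_top : (2 : ℕ∞) ≤ ⊤))
  have hx : px (py f) z = fderiv ℝ (fderiv ℝ f) z (1, 0) (0, 1) := by
    change fderiv ℝ (fun w => fderiv ℝ f w (0, 1)) z (1, 0) = _
    rw [fderiv_clm_apply hf' (differentiableAt_const _)]
    simp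
  have hy : py (px f) z = fderiv ℝ (fderiv ℝ f) z (0, 1) (1, 0) := by
    change fderiv ℝ (fun w => fderiv ℝ f w (1, 0)) z (0, 1) = _
    rw [fderiv_clm_apply hf' (differentiableAt_const _)]
    simp
  rw [hx, hy, hsymm]

end PartialDerivatives

/-! ### Second-order linear systems as first-order systems for jets -/

/-- The linear map `(s, p, q) ↦ (k, a • (s, p, q), b • (s, p, q))`, with `k` a linear form. -/
def jetMap (k : ℝ × ℝ × ℝ →L[ℝ] ℝ) (a₁ a₂ a₃ b₁ b₂ b₃ : ℝ) :
    ℝ × ℝ × ℝ →L[ℝ] ℝ × ℝ × ℝ :=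
  let S := ContinuousLinearMap.fst ℝ ℝ (ℝ × ℝ)
  let P := (ContinuousLinearMap.fst ℝ ℝ ℝ) ∘L (ContinuousLinearMap.snd ℝ ℝ (ℝ × ℝ))
  let Q := (ContinuousLinearMap.snd ℝ ℝ ℝ) ∘L (ContinuousLinearMap.snd ℝ ℝ (ℝ × ℝ))
  k.prod ((a₁ • S + a₂ • P + a₃ • Q).prod (b₁ • S + b₂ • P + b₃ • Q))

theorem jetMap_apply (k : ℝ × ℝ × ℝ →L[ℝ] ℝ) (a₁ a₂ a₃ b₁ b₂ b₃ : ℝ) (w : ℝ × ℝ × ℝ) :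
    jetMap k a₁ a₂ a₃ b₁ b₂ b₃ w = (k w, a₁ * w.1 + a₂ * w.2.1 + a₃ * w.2.2,
      b₁ * w.1 + b₂ * w.2.1 + b₃ * w.2.2) := rfl

theorem contDiffOn_jetMap (k : ℝ × ℝ × ℝ →L[ℝ] ℝ) {U : Set (ℝ × ℝ)}
    {a₁ a₂ a₃ b₁ b₂ b₃ : ℝ × ℝ → ℝ}
    (h₁ : ContDiffOn ℝ ∞ a₁ U) (h₂ : ContDiffOn ℝ ∞ a₂ U) (h₃ : ContDiffOn ℝ ∞ a₃ U)
    (k₁ : ContDiffOn ℝ ∞ b₁ U) (k₂ : ContDiffOn ℝ ∞ b₂ U) (k₃ : ContDiffOn ℝ ∞ b₃ U) :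
    ContDiffOn ℝ ∞ (fun z => jetMap k (a₁ z) (a₂ z) (a₃ z) (b₁ z) (b₂ z) (b₃ z)) U := by
  rw [contDiffOn_clm_apply]
  intro w
  simp only [jetMap_apply]
  fun_prop

theorem fderiv_jetMap_apply (k : ℝ × ℝ × ℝ →L[ℝ] ℝ) {z v : ℝ × ℝ}
    {a₁ a₂ a₃ b₁ b₂ b₃ : ℝ × ℝ → ℝ}
    (h₁ : DifferentiableAt ℝ a₁ z) (h₂ : DifferentiableAt ℝ a₂ z) (h₃ : DifferentiableAt ℝ a₃ z)
    (k₁ : DifferentiableAt ℝ b₁ z) (k₂ : DifferentiableAt ℝ b₂ z) (k₃ : DifferentiableAt ℝ b₃ z)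
    (hM : DifferentiableAt ℝ
      (fun z => jetMap k (a₁ z) (a₂ z) (a₃ z) (b₁ z) (b₂ z) (b₃ z)) z) (w : ℝ × ℝ × ℝ) :
    fderiv ℝ (fun z => jetMap k (a₁ z) (a₂ z) (a₃ z) (b₁ z) (b₂ z) (b₃ z)) z v w =
      (0, fderiv ℝ a₁ z v * w.1 + fderiv ℝ a₂ z v * w.2.1 + fderiv ℝ a₃ z v * w.2.2,
        fderiv ℝ b₁ z v * w.1 + fderiv ℝ b₂ z v * w.2.1 + fderiv ℝ b₃ z v * w.2.2) := by
  have h1 := hM.hasFDerivAt.clm_apply (hasFDerivAt_const w z)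
  have hlin : ∀ {c₁ c₂ c₃ : ℝ × ℝ → ℝ}, DifferentiableAt ℝ c₁ z → DifferentiableAt ℝ c₂ z →
      DifferentiableAt ℝ c₃ z → HasFDerivAt
        (fun z => c₁ z * w.1 + c₂ z * w.2.1 + c₃ z * w.2.2)
        (w.1 • fderiv ℝ c₁ z + w.2.1 • fderiv ℝ c₂ z + w.2.2 • fderiv ℝ c₃ z) z :=
    fun q₁ q₂ q₃ => ((q₁.hasFDerivAt.mul_const _).fun_add (q₂.hasFDerivAt.mul_const _)).fun_add
      (q₃.hasFDerivAt.mul_const _)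
  have h2 := (hasFDerivAt_const (k w) z).prodMk ((hlin h₁ h₂ h₃).prodMk (hlin k₁ k₂ k₃))
  have h3 := congrArg (fun L => L v) (h1.unique h2)
  simp only [ContinuousLinearMap.comp_zero, zero_add, ContinuousLinearMap.flip_apply] at h3
  rw [h3]
  simp [mul_comm]

/-- Local solvability of a compatible closed linear second-order system for one function, with
arbitrary initial values for the function and its first derivatives. -/
theorem exists_solution_second_order_system {U : Set (ℝ × ℝ)} (hU : IsOpen U)
    {a₁ a₂ a₃ b₁ b₂ b₃ e₁ e₂ e₃ : ℝ × ℝ → ℝ}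
    (ha₁ : ContDiffOn ℝ ∞ a₁ U) (ha₂ : ContDiffOn ℝ ∞ a₂ U) (ha₃ : ContDiffOn ℝ ∞ a₃ U)
    (hb₁ : ContDiffOn ℝ ∞ b₁ U) (hb₂ : ContDiffOn ℝ ∞ b₂ U) (hb₃ : ContDiffOn ℝ ∞ b₃ U)
    (he₁ : ContDiffOn ℝ ∞ e₁ U) (he₂ : ContDiffOn ℝ ∞ e₂ U) (he₃ : ContDiffOn ℝ ∞ e₃ U)
    (hcompat : ∀ z ∈ U,
      py a₁ z + a₂ z * b₁ z + a₃ z * e₁ z = px b₁ z + b₂ z * a₁ z + b₃ z * b₁ z ∧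
      py a₂ z + a₂ z * b₂ z + a₃ z * e₂ z = px b₂ z + b₁ z + b₂ z * a₂ z + b₃ z * b₂ z ∧
      py a₃ z + a₁ z + a₂ z * b₃ z + a₃ z * e₃ z = px b₃ z + b₂ z * a₃ z + b₃ z * b₃ z ∧
      py b₁ z + b₂ z * b₁ z + b₃ z * e₁ z = px e₁ z + e₂ z * a₁ z + e₃ z * b₁ z ∧
      py b₂ z + b₂ z * b₂ z + b₃ z * e₂ z = px e₂ z + e₁ z + e₂ z * a₂ z + e₃ z * b₂ z ∧
      py b₃ z + b₁ z + b₂ z * b₃ z + b₃ z * e₃ z = px e₃ z + e₂ z * a₃ z + e₃ z * b₃ z)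
    {z₀ : ℝ × ℝ} (hz₀ : z₀ ∈ U) :
    ∃ V : Set (ℝ × ℝ), IsOpen V ∧ z₀ ∈ V ∧ V ⊆ U ∧ ∀ s p q : ℝ, ∃ ψ : ℝ × ℝ → ℝ,
      ψ z₀ = s ∧ px ψ z₀ = p ∧ py ψ z₀ = q ∧ ContDiffOn ℝ ∞ ψ V ∧ ∀ z ∈ V,
        px (px ψ) z = a₁ z * ψ z + a₂ z * px ψ z + a₃ z * py ψ z ∧
        px (py ψ) z = b₁ z * ψ z + b₂ z * px ψ z + b₃ z * py ψ z ∧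
        py (py ψ) z = e₁ z * ψ z + e₂ z * px ψ z + e₃ z * py ψ z := by
  have hd : ∀ {f : ℝ × ℝ → ℝ}, ContDiffOn ℝ ∞ f U → ∀ z ∈ U, DifferentiableAt ℝ f z :=
    fun hf z hz => differentiableAt_of_contDiffOn hU hf hz
  -- M and N give the x- and y-derivatives of the jet (ψ, ψ_x, ψ_y).
  obtain ⟨M, hMdef⟩ : ∃ M, M = fun z => jetMap
    ((ContinuousLinearMap.fst ℝ ℝ ℝ) ∘L (ContinuousLinearMap.snd ℝ ℝ (ℝ × ℝ)))
    (a₁ z) (a₂ z) (a₃ z) (b₁ z) (b₂ z) (b₃ z) := ⟨_, rfl⟩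
  obtain ⟨N, hNdef⟩ : ∃ N, N = fun z => jetMap
    ((ContinuousLinearMap.snd ℝ ℝ ℝ) ∘L (ContinuousLinearMap.snd ℝ ℝ (ℝ × ℝ)))
    (b₁ z) (b₂ z) (b₃ z) (e₁ z) (e₂ z) (e₃ z) := ⟨_, rfl⟩
  have hM : ContDiffOn ℝ ∞ M U := hMdef ▸ contDiffOn_jetMap _ ha₁ ha₂ ha₃ hb₁ hb₂ hb₃
  have hN : ContDiffOn ℝ ∞ N U := hNdef ▸ contDiffOn_jetMap _ hb₁ hb₂ hb₃ he₁ he₂ he₃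
  have hMz : ∀ z w, M z w = (w.2.1, a₁ z * w.1 + a₂ z * w.2.1 + a₃ z * w.2.2,
      b₁ z * w.1 + b₂ z * w.2.1 + b₃ z * w.2.2) := fun z w => by rw [hMdef]; rfl
  have hNz : ∀ z w, N z w = (w.2.2, b₁ z * w.1 + b₂ z * w.2.1 + b₃ z * w.2.2,
      e₁ z * w.1 + e₂ z * w.2.1 + e₃ z * w.2.2) := fun z w => by rw [hNdef]; rfl
  have hMN : ∀ z ∈ U,
      fderiv ℝ M z (0, 1) + M z ∘L N z = fderiv ℝ N z (1, 0) + N z ∘L M z := by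
    intro z hz
    obtain ⟨c1, c2, c3, c4, c5, c6⟩ := hcompat z hz
    have hM' := (hM.contDiffAt (hU.mem_nhds hz)).differentiableAt (by simp)
    have hN' := (hN.contDiffAt (hU.mem_nhds hz)).differentiableAt (by simp)
    refine ContinuousLinearMap.ext fun w => ?_
    have hMd : fderiv ℝ M z (0, 1) w =
        (0, fderiv ℝ a₁ z (0, 1) * w.1 + fderiv ℝ a₂ z (0, 1) * w.2.1 + fderiv ℝ a₃ z (0, 1) * w.2.2,
          fderiv ℝ b₁ z (0, 1) * w.1 + fderiv ℝ b₂ z (0, 1) * w.2.1 + fderiv ℝ b₃ z (0, 1) * w.2.2) := by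
      subst hMdef
      exact fderiv_jetMap_apply _ (hd ha₁ z hz) (hd ha₂ z hz) (hd ha₃ z hz) (hd hb₁ z hz)
        (hd hb₂ z hz) (hd hb₃ z hz) hM' w
    have hNd : fderiv ℝ N z (1, 0) w =
        (0, fderiv ℝ b₁ z (1, 0) * w.1 + fderiv ℝ b₂ z (1, 0) * w.2.1 + fderiv ℝ b₃ z (1, 0) * w.2.2,
          fderiv ℝ e₁ z (1, 0) * w.1 + fderiv ℝ e₂ z (1, 0) * w.2.1 + fderiv ℝ e₃ z (1, 0) * w.2.2) := by
      subst hNdef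
      exact fderiv_jetMap_apply _ (hd hb₁ z hz) (hd hb₂ z hz) (hd hb₃ z hz) (hd he₁ z hz)
        (hd he₂ z hz) (hd he₃ z hz) hN' w
    simp only [add_apply, ContinuousLinearMap.comp_apply, hMd, hNd]
    rw [hMz z w, hNz z w, hMz, hNz]
    simp only [Prod.mk_add_mk, Prod.mk.injEq]
    simp only [px, py] at c1 c2 c3 c4 c5 c6
    -- The first row is automatic, since M and N share the row for ψ_xy. The other two rows each
    -- contribute three scalar conditions.
    refine ⟨by simp, ?_, ?_⟩
    · linear_combination w.1 * c1 + w.2.1 * c2 + w.2.2 * c3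
    · linear_combination w.1 * c4 + w.2.1 * c5 + w.2.2 * c6
  obtain ⟨V, hV, hz₀V, hVU, hsol⟩ := exists_hasFDerivAt_linear_system hU hM hN hMN hz₀
  refine ⟨V, hV, hz₀V, hVU, fun s p q => ?_⟩
  obtain ⟨Ψ, hΨ0, hΨ⟩ := hsol (s, p, q)
  have hsm : ContDiffOn ℝ ∞ Ψ V :=
    contDiffOn_of_hasFDerivAt_linear_system hV (hM.mono hVU) (hN.mono hVU) hΨ
  have hx : ∀ z ∈ V, ∀ L : ℝ × ℝ × ℝ →L[ℝ] ℝ, px (fun z => L (Ψ z)) z = L (M z (Ψ z)) := by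
    intro z hz L
    have := (L.hasFDerivAt.comp z (hΨ z hz)).fderiv
    change fderiv ℝ (L ∘ Ψ) z (1, 0) = _
    rw [this]
    simp
  have hy : ∀ z ∈ V, ∀ L : ℝ × ℝ × ℝ →L[ℝ] ℝ, py (fun z => L (Ψ z)) z = L (N z (Ψ z)) := by
    intro z hz L
    have := (L.hasFDerivAt.comp z (hΨ z hz)).fderiv
    change fderiv ℝ (L ∘ Ψ) z (0, 1) = _
    rw [this]
    simp
  let S := ContinuousLinearMap.fst ℝ ℝ (ℝ × ℝ)
  let P := (ContinuousLinearMap.fst ℝ ℝ ℝ) ∘L (ContinuousLinearMap.snd ℝ ℝ (ℝ × ℝ))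
  let Q := (ContinuousLinearMap.snd ℝ ℝ ℝ) ∘L (ContinuousLinearMap.snd ℝ ℝ (ℝ × ℝ))
  have hpx : Set.EqOn (px fun z => S (Ψ z)) (fun z => P (Ψ z)) V := fun z hz => by
    rw [hx z hz, hMz]; rfl
  have hpy : Set.EqOn (py fun z => S (Ψ z)) (fun z => Q (Ψ z)) V := fun z hz => by
    rw [hy z hz, hNz]; rfl
  refine ⟨fun z => S (Ψ z), ?_, ?_, ?_, S.contDiff.comp_contDiffOn hsm, fun z hz => ⟨?_, ?_, ?_⟩⟩
  · exact congrArg S hΨ0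
  · exact (hpx hz₀V).trans (congrArg P hΨ0)
  · exact (hpy hz₀V).trans (congrArg Q hΨ0)
  · rw [px_congr hV hpx hz, hx z hz, hMz, hpx hz, hpy hz]; rfl
  · rw [px_congr hV hpy hz, hx z hz, hMz, hpx hz, hpy hz]; rfl
  · rw [py_congr hV hpy hz, hy z hz, hNz, hpx hz, hpy hz]; rfl

/-! ### Lie's criteria and Lie's theorem -/

/-- The Lie criteria are the integrability conditions of the auxiliary system for `b` and `e`. -/
theorem LieCriteriaAux.lieCriteria {U : Set (ℝ × ℝ)} (hU : IsOpen U) {c g h d : ℝ × ℝ → ℝ}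
    (hc : ContDiffOn ℝ ∞ c U) (hg : ContDiffOn ℝ ∞ g U) (hh : ContDiffOn ℝ ∞ h U)
    (hd : ContDiffOn ℝ ∞ d U) (H : LieCriteriaAux U c g h d) : LieCriteria U c g h d := by
  obtain ⟨a, b, e, f, -, hb, he, -, H⟩ := H
  have hbx : Set.EqOn (px b)
      (fun w => c w * d w - b w * e w - 2 / 3 * px g w - 1 / 3 * py h w) U := fun w hw => by
    obtain ⟨-, -, h1, -, -, -⟩ := H w hw
    linear_combination h1 / 3
  have hby : Set.EqOn (py b)
      (fun w => px c w - b w * b w - b w * g w - c w * h w - c w * e w) U := fun w hw => by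
    obtain ⟨-, -, -, h1, -, -⟩ := H w hw
    linear_combination h1
  have hex : Set.EqOn (px e)
      (fun w => py d w - b w * d w - d w * g w - e w * e w - e w * h w) U := fun w hw => by
    obtain ⟨-, -, -, -, h1, -⟩ := H w hw
    linear_combination -h1
  have hey : Set.EqOn (py e)
      (fun w => c w * d w - b w * e w - 2 / 3 * py h w - 1 / 3 * px g w) U := fun w hw => by
    obtain ⟨-, -, -, -, -, h1⟩ := H w hw
    linear_combination h1 / 3
  intro z hz
  have D : ∀ {F : ℝ × ℝ → ℝ}, ContDiffOn ℝ ∞ F U → DifferentiableAt ℝ F z := fun hF =>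
    differentiableAt_of_contDiffOn hU hF hz
  have dc := D hc
  have dg := D hg
  have dh := D hh
  have dd := D hd
  have db := D hb
  have de := D he
  have dcx := D (contDiffOn_px hU hc)
  have ddy := D (contDiffOn_py hU hd)
  have dgx := D (contDiffOn_px hU hg)
  have dhy := D (contDiffOn_py hU hh)
  have b1 := py_congr hU hbx hz
  have b2 := px_congr hU hby hz
  have e1 := py_congr hU hex hz
  have e2 := px_congr hU hey hz
  -- Equate the two mixed derivatives of b, and likewise of e. Once their first derivatives are
  -- substituted, b and e cancel and the criteria remain.
  rw [← px_py_comm hU hb hz, b2] at b1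
  rw [← px_py_comm hU he hz, e2] at e1
  simp (disch := fun_prop) only [px_sub, px_mul, py_sub, py_mul, px_const, py_const] at b1 e1
  rw [← px_py_comm hU hg hz, hbx hz, hby hz, hex hz, hey hz] at b1
  rw [hbx hz, hby hz, hex hz, hey hz] at e1
  rw [px_mul dc dh, py_mul dc dd, py_mul dd dg, px_mul dc dd]
  constructor
  · linear_combination -3 * b1
  · linear_combination 3 * e1

/-- If `ψ` and `uψ` solve the same closed linear second-order system, then `u` solves a
second-order system without zeroth-order terms. -/
theorem quotient_second_order_system {W : Set (ℝ × ℝ)} (hW : IsOpen W) {u ψ χ : ℝ × ℝ → ℝ}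
    (hu : ContDiffOn ℝ ∞ u W) (hψ : ContDiffOn ℝ ∞ ψ W) (hχ : Set.EqOn χ (fun w => u w * ψ w) W)
    {z : ℝ × ℝ} (hz : z ∈ W) {a₁ a₂ a₃ b₁ b₂ b₃ e₁ e₂ e₃ : ℝ}
    (hψz : px (px ψ) z = a₁ * ψ z + a₂ * px ψ z + a₃ * py ψ z ∧
        px (py ψ) z = b₁ * ψ z + b₂ * px ψ z + b₃ * py ψ z ∧
        py (py ψ) z = e₁ * ψ z + e₂ * px ψ z + e₃ * py ψ z)
    (hχz : px (px χ) z = a₁ * χ z + a₂ * px χ z + a₃ * py χ z ∧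
        px (py χ) z = b₁ * χ z + b₂ * px χ z + b₃ * py χ z ∧
        py (py χ) z = e₁ * χ z + e₂ * px χ z + e₃ * py χ z) :
    px (px u) z * ψ z + 2 * (px u z * px ψ z) = (a₂ * px u z + a₃ * py u z) * ψ z ∧
    px (py u) z * ψ z + px u z * py ψ z + py u z * px ψ z =
      (b₂ * px u z + b₃ * py u z) * ψ z ∧
    py (py u) z * ψ z + 2 * (py u z * py ψ z) = (e₂ * px u z + e₃ * py u z) * ψ z := by
  have D : ∀ {F : ℝ × ℝ → ℝ}, ContDiffOn ℝ ∞ F W → ∀ w ∈ W, DifferentiableAt ℝ F w :=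
    fun hF w hw => differentiableAt_of_contDiffOn hW hF hw
  have hχx : Set.EqOn (px χ) (fun w => px u w * ψ w + u w * px ψ w) W := fun w hw =>
    (px_congr hW hχ hw).trans (px_mul (D hu w hw) (D hψ w hw))
  have hχy : Set.EqOn (py χ) (fun w => py u w * ψ w + u w * py ψ w) W := fun w hw =>
    (py_congr hW hχ hw).trans (py_mul (D hu w hw) (D hψ w hw))
  have du := D hu z hz
  have dψ := D hψ z hz
  have dux := D (contDiffOn_px hW hu) z hz
  have duy := D (contDiffOn_py hW hu) z hz
  have dψx := D (contDiffOn_px hW hψ) z hz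
  have dψy := D (contDiffOn_py hW hψ) z hz
  have xx := px_congr hW hχx hz
  have xy := px_congr hW hχy hz
  have yy := py_congr hW hχy hz
  simp (disch := fun_prop) only [px_add, px_mul, py_add, py_mul] at xx xy yy
  obtain ⟨p1, p2, p3⟩ := hψz
  obtain ⟨q1, q2, q3⟩ := hχz
  rw [hχx hz, hχy hz, hχ hz] at q1 q2 q3
  refine ⟨?_, ?_, ?_⟩
  -- Subtracting u times the equation for ψ from that for χ = uψ removes the zeroth-order term.
  · linear_combination q1 - xx - u z * p1
  · linear_combination q2 - xy - u z * p2
  · linear_combination q3 - yy - u z * p3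

/-- The cubic equation satisfied by the unparametrized straight lines in the coordinates
`(u, v)`. -/
theorem eq_cubicRHS_iff_newQ_eq_zero {u v c g h d ψ : ℝ × ℝ → ℝ} {z : ℝ × ℝ} (hψ : ψ z ≠ 0)
    (hjac : jac u v z ≠ 0)
    (hu : px (px u) z * ψ z + 2 * (px u z * px ψ z) =
        (-(1 / 3 * h z) * px u z + -d z * py u z) * ψ z ∧
      px (py u) z * ψ z + px u z * py ψ z + py u z * px ψ z =
        (1 / 3 * g z * px u z + 1 / 3 * h z * py u z) * ψ z ∧
      py (py u) z * ψ z + 2 * (py u z * py ψ z) = (-c z * px u z + -(1 / 3 * g z) * py u z) * ψ z)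
    (hv : px (px v) z * ψ z + 2 * (px v z * px ψ z) =
        (-(1 / 3 * h z) * px v z + -d z * py v z) * ψ z ∧
      px (py v) z * ψ z + px v z * py ψ z + py v z * px ψ z =
        (1 / 3 * g z * px v z + 1 / 3 * h z * py v z) * ψ z ∧
      py (py v) z * ψ z + 2 * (py v z * py ψ z) = (-c z * px v z + -(1 / 3 * g z) * py v z) * ψ z)
    {p q : ℝ} (hp : D1 u z p ≠ 0) : q = cubicRHS c g h d z p ↔ newQ u v z p q = 0 := by
  have key : D1 u z p * D2 v z p q - D1 v z p * D2 u z p q =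
      (q - cubicRHS c g h d z p) * jac u v z := by
    refine mul_right_cancel₀ hψ ?_
    obtain ⟨u1, u2, u3⟩ := hu
    obtain ⟨v1, v2, v3⟩ := hv
    simp only [D1, D2, cubicRHS, jac]
    -- The combination with weights 1, 2p, p² collects the derivatives of ψ into 2 (u_x + p u_y)(ψ_x
    -- + p ψ_y), and similarly for v. These terms cancel on antisymmetrizing in u and v.
    linear_combination (px u z + p * py u z) * (v1 + 2 * p * v2 + p ^ 2 * v3) -
      (px v z + p * py v z) * (u1 + 2 * p * u2 + p ^ 2 * u3)
  rw [newQ, key, div_eq_zero_iff, mul_eq_zero, sub_eq_zero]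
  simp [hjac, hp]

/-- Lie's theorem: the Lie criteria imply linearizability by point transformations. -/
theorem LieCriteria.isLieLinearizable {U : Set (ℝ × ℝ)} (hU : IsOpen U) {c g h d : ℝ × ℝ → ℝ}
    (hc : ContDiffOn ℝ ∞ c U) (hg : ContDiffOn ℝ ∞ g U) (hh : ContDiffOn ℝ ∞ h U)
    (hd : ContDiffOn ℝ ∞ d U) (H : LieCriteria U c g h d) :
    IsLieLinearizable U (cubicRHS c g h d) := by
  intro z₀ hz₀
  have scx := contDiffOn_px hU hc
  have sgx := contDiffOn_px hU hg
  have sgy := contDiffOn_py hU hg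
  have shx := contDiffOn_px hU hh
  have shy := contDiffOn_py hU hh
  have sdy := contDiffOn_py hU hd
  -- The zeroth-order coefficients are forced by the compatibility conditions that carry no
  -- derivatives of them.
  obtain ⟨m₀, hm₀⟩ : ∃ m : ℝ × ℝ → ℝ, m = fun w =>
    2 / 9 * (h w * h w) + py d w - 2 / 3 * (d w * g w) + 1 / 3 * px h w := ⟨_, rfl⟩
  obtain ⟨m₁, hm₁⟩ : ∃ m : ℝ × ℝ → ℝ, m = fun w =>
    c w * d w - 1 / 3 * py h w - 1 / 3 * px g w - 1 / 9 * (g w * h w) := ⟨_, rfl⟩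
  obtain ⟨m₂, hm₂⟩ : ∃ m : ℝ × ℝ → ℝ, m = fun w =>
    1 / 3 * py g w + 2 / 9 * (g w * g w) - 2 / 3 * (c w * h w) + px c w := ⟨_, rfl⟩
  obtain ⟨V, hV, hzV, hVU, hsol⟩ := exists_solution_second_order_system hU
    (a₁ := m₀) (a₂ := fun w => -(1 / 3 * h w)) (a₃ := fun w => -d w)
    (b₁ := m₁) (b₂ := fun w => 1 / 3 * g w) (b₃ := fun w => 1 / 3 * h w)
    (e₁ := m₂) (e₂ := fun w => -c w) (e₃ := fun w => -(1 / 3 * g w))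
    (by rw [hm₀]; fun_prop) (by fun_prop) (by fun_prop)
    (by rw [hm₁]; fun_prop) (by fun_prop) (by fun_prop)
    (by rw [hm₂]; fun_prop) (by fun_prop) (by fun_prop)
    (fun z hz => by
      have D : ∀ {F : ℝ × ℝ → ℝ}, ContDiffOn ℝ ∞ F U → DifferentiableAt ℝ F z := fun hF =>
        differentiableAt_of_contDiffOn hU hF hz
      have dc := D hc
      have dg := D hg
      have dh := D hh
      have dd := D hd
      have dcx := D scx
      have dgx := D sgx
      have dgy := D sgy
      have dhx := D shx
      have dhy := D shy
      have ddy := D sdy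
      obtain ⟨H1, H2⟩ := H z hz
      rw [px_mul dc dh, py_mul dc dd] at H1
      rw [py_mul dd dg, px_mul dc dd] at H2
      subst hm₀ hm₁ hm₂
      simp (disch := fun_prop) only [px_add, px_sub, px_mul, px_neg, px_const, py_add, py_sub,
        py_mul, py_neg, py_const, ← px_py_comm hU hh hz, ← px_py_comm hU hg hz]
      -- The conditions in the ψ_x and ψ_y coefficients hold by the choice of m₀, m₁, m₂; those in
      -- the ψ coefficient are the two Lie criteria.
      refine ⟨?_, ?_, ?_, ?_, ?_, ?_⟩
      · linear_combination -H2 / 3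
      · ring
      · ring
      · linear_combination H1 / 3
      · ring
      · ring) hz₀
  -- With these initial jets the ratios χ/ψ and ρ/ψ have the identity as Jacobian matrix at z₀, so
  -- the inverse function theorem gives injectivity nearby.
  obtain ⟨ψ, hψ0, hψx0, hψy0, hψ, hψs⟩ := hsol 1 0 0
  obtain ⟨χ, hχ0, hχx0, hχy0, hχ, hχs⟩ := hsol 0 1 0
  obtain ⟨ρ, hρ0, hρx0, hρy0, hρ, hρs⟩ := hsol 0 0 1
  have hW : IsOpen (V ∩ ψ ⁻¹' {0}ᶜ) :=
    hψ.continuousOn.isOpen_inter_preimage hV isOpen_compl_singleton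
  obtain ⟨W, hWdef⟩ : ∃ W, W = V ∩ ψ ⁻¹' {0}ᶜ := ⟨_, rfl⟩
  rw [← hWdef] at hW
  have hWV : W ⊆ V := hWdef ▸ Set.inter_subset_left
  have hWψ : ∀ z ∈ W, ψ z ≠ 0 := fun z hz => (hWdef ▸ hz : z ∈ V ∩ ψ ⁻¹' {0}ᶜ).2
  have hzW : z₀ ∈ W := by rw [hWdef]; exact ⟨hzV, by simp [hψ0]⟩
  have hψW := hψ.mono hWV
  obtain ⟨u, hu⟩ : ∃ u : ℝ × ℝ → ℝ, u = fun z => χ z / ψ z := ⟨_, rfl⟩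
  obtain ⟨v, hv⟩ : ∃ v : ℝ × ℝ → ℝ, v = fun z => ρ z / ψ z := ⟨_, rfl⟩
  have su : ContDiffOn ℝ ∞ u W := hu ▸ (hχ.mono hWV).div hψW hWψ
  have sv : ContDiffOn ℝ ∞ v W := hv ▸ (hρ.mono hWV).div hψW hWψ
  have huψ : Set.EqOn χ (fun w => u w * ψ w) W := fun w hw => by
    simp only [hu]; exact (div_mul_cancel₀ _ (hWψ w hw)).symm
  have hvψ : Set.EqOn ρ (fun w => v w * ψ w) W := fun w hw => by
    simp only [hv]; exact (div_mul_cancel₀ _ (hWψ w hw)).symm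
  have du := differentiableAt_of_contDiffOn hW su hzW
  have dv := differentiableAt_of_contDiffOn hW sv hzW
  have dψ := differentiableAt_of_contDiffOn hW hψW hzW
  have hux : px u z₀ = 1 := by
    have := px_congr hW huψ hzW
    rw [px_mul du dψ, hχx0, hψ0, hψx0] at this
    linarith
  have huy : py u z₀ = 0 := by
    have := py_congr hW huψ hzW
    rw [py_mul du dψ, hχy0, hψ0, hψy0] at this
    linarith
  have hvx : px v z₀ = 0 := by
    have := px_congr hW hvψ hzW
    rw [px_mul dv dψ, hρx0, hψ0, hψx0] at this
    linarith
  have hvy : py v z₀ = 1 := by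
    have := py_congr hW hvψ hzW
    rw [py_mul dv dψ, hρy0, hψ0, hψy0] at this
    linarith
  have hjac : ContinuousOn (jac u v) W :=
    (((contDiffOn_px hW su).mul (contDiffOn_py hW sv)).sub
      ((contDiffOn_py hW su).mul (contDiffOn_px hW sv))).continuousOn
  have hstrict : HasStrictFDerivAt (fun z => (u z, v z))
      ((ContinuousLinearEquiv.refl ℝ (ℝ × ℝ) : (ℝ × ℝ) ≃L[ℝ] ℝ × ℝ) :
        (ℝ × ℝ) →L[ℝ] ℝ × ℝ) z₀ := by
    have h1 := ((su.contDiffAt (hW.mem_nhds hzW)).hasStrictFDerivAt (by simp)).prodMk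
      ((sv.contDiffAt (hW.mem_nhds hzW)).hasStrictFDerivAt (by simp))
    simp only [px, py] at hux huy hvx hvy
    have h2 : ((ContinuousLinearEquiv.refl ℝ (ℝ × ℝ) : (ℝ × ℝ) ≃L[ℝ] ℝ × ℝ) :
        (ℝ × ℝ) →L[ℝ] ℝ × ℝ) = (fderiv ℝ u z₀).prod (fderiv ℝ v z₀) := by
      ext <;> simp [hux, huy, hvx, hvy]
    rw [h2]
    exact h1
  let Φ := hstrict.toOpenPartialHomeomorph _
  have hΦ : Set.InjOn (fun z => (u z, v z)) Φ.source := Φ.injOn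
  have hzΦ : z₀ ∈ Φ.source := hstrict.mem_toOpenPartialHomeomorph_source
  refine ⟨(W ∩ jac u v ⁻¹' {0}ᶜ) ∩ Φ.source,
    (hjac.isOpen_inter_preimage hW isOpen_compl_singleton).inter Φ.open_source,
    ⟨⟨hzW, by simp [jac, hux, huy, hvx, hvy]⟩, hzΦ⟩, fun z hz => hVU (hWV hz.1.1), u, v,
    ⟨su.mono fun z hz => hz.1.1, sv.mono fun z hz => hz.1.1, hΦ.mono Set.inter_subset_right,
      fun z hz => hz.1.2⟩,
    -- The linear equation reached is d²v/du² = 0.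
    Set.univ, fun _ => 0, fun _ => 0, fun _ => 0, isOpen_univ, Set.mapsTo_univ _ _,
    contDiffOn_const, contDiffOn_const, contDiffOn_const, ?_⟩
  rintro z ⟨⟨hz, hjz⟩, -⟩ p hp q
  simp only [zero_mul, add_zero]
  exact eq_cubicRHS_iff_newQ_eq_zero (hWψ z hz) hjz
    (quotient_second_order_system hW su hψW huψ hz (hψs z (hWV hz)) (hχs z (hWV hz)))
    (quotient_second_order_system hW sv hψW hvψ hz (hψs z (hWV hz)) (hρs z (hWV hz))) hp

/-! ### The third-order equation -/

/-- The third-order equation obtained by differentiating a cubically semi-linear second-order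
equation has a right-hand side of degree five in `y'`. -/
theorem arisesByDifferentiating_quinticRHS {U : Set (ℝ × ℝ)} {α β γ δ ε φ c g h d : ℝ × ℝ → ℝ}
    (hc : ∀ z ∈ U, DifferentiableAt ℝ c z) (hg : ∀ z ∈ U, DifferentiableAt ℝ g z)
    (hh : ∀ z ∈ U, DifferentiableAt ℝ h z) (hd : ∀ z ∈ U, DifferentiableAt ℝ d z)
    (hα : ∀ z ∈ U, α z = 3 * c z ^ 2) (hβ : ∀ z ∈ U, β z = 5 * c z * g z + py c z)
    (hγ : ∀ z ∈ U, γ z = 4 * c z * h z + 2 * g z ^ 2 + py g z - px c z)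
    (hδ : ∀ z ∈ U, δ z = 3 * c z * d z + 3 * g z * h z + py h z - px g z)
    (hε : ∀ z ∈ U, ε z = 2 * d z * g z + h z ^ 2 + py d z - px h z)
    (hφ : ∀ z ∈ U, φ z = d z * h z - px d z) :
    ArisesByDifferentiating U (quinticRHS α β γ δ ε φ) (cubicRHS c g h d) := by
  intro z hz p
  have dc := hc z hz
  have dg := hg z hz
  have dh := hh z hz
  have dd := hd z hz
  have hp : deriv (cubicRHS c g h d z) p = -(c z * (3 * p ^ 2)) + g z * (2 * p) - h z := by
    have h1 := (((((hasDerivAt_pow 3 p).const_mul (c z)).fun_neg).fun_add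
      ((hasDerivAt_pow 2 p).const_mul (g z))).fun_sub
      ((hasDerivAt_id p).const_mul (h z))).add_const (d z)
    have h2 : deriv (cubicRHS c g h d z) p = _ := h1.deriv
    rw [h2]
    norm_num
  rw [totalDeriv, hp]
  simp only [cubicRHS, quinticRHS]
  simp (disch := fun_prop) only [px_add, px_sub, px_mul, px_neg, px_const, py_add, py_sub, py_mul,
    py_neg, py_const]
  rw [hα z hz, hβ z hz, hγ z hz, hδ z hz, hε z hz, hφ z hz]
  ring

end LieODE

theorem theorem1 (U : Set (ℝ × ℝ)) (hU : IsOpen U)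
    (α β γ δ ε φ c g h d : ℝ × ℝ → ℝ)
    (hα : ContDiffOn ℝ ∞ α U) (hβ : ContDiffOn ℝ ∞ β U) (hγ : ContDiffOn ℝ ∞ γ U)
    (hδ : ContDiffOn ℝ ∞ δ U) (hε : ContDiffOn ℝ ∞ ε U) (hφ : ContDiffOn ℝ ∞ φ U)
    (hc : ContDiffOn ℝ ∞ c U) (hc0 : ∀ z ∈ U, c z ≠ 0)
    (h_c : ∀ z ∈ U, c z ^ 2 = α z / 3)
    (h_g : ∀ z ∈ U, g z = (β z - LieODE.py c z) / (5 * c z))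
    (h_h : ∀ z ∈ U, h z = (γ z - 2 * g z ^ 2 - LieODE.py g z + LieODE.px c z) / (4 * c z))
    (h_d : ∀ z ∈ U,
      d z = (δ z - 3 * g z * h z - LieODE.py h z + LieODE.px g z) / (3 * c z))
    (h_ε : ∀ z ∈ U,
      ε z = 2 * d z * g z + h z ^ 2 + LieODE.py d z - LieODE.px h z)
    (h_φ : ∀ z ∈ U, φ z = d z * h z - LieODE.px d z)
    (hLie : LieODE.LieCriteria U c g h d ∨ LieODE.LieCriteriaAux U c g h d) :
    LieODE.IsLinearizable U (LieODE.quinticRHS α β γ δ ε φ) := by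
  -- Smoothness passes from c to g, then h, then d, since each formula involves only earlier
  -- coefficients and divides by a multiple of c.
  have hg : ContDiffOn ℝ ∞ g U :=
    ((hβ.sub (LieODE.contDiffOn_py hU hc)).div (contDiffOn_const.mul hc)
      fun z hz => mul_ne_zero (by norm_num) (hc0 z hz)).congr h_g
  have hh : ContDiffOn ℝ ∞ h U :=
    ((((hγ.sub (contDiffOn_const.mul (hg.pow 2))).sub (LieODE.contDiffOn_py hU hg)).add
      (LieODE.contDiffOn_px hU hc)).div (contDiffOn_const.mul hc)
      fun z hz => mul_ne_zero (by norm_num) (hc0 z hz)).congr h_h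
  have hd : ContDiffOn ℝ ∞ d U :=
    ((((hδ.sub ((contDiffOn_const.mul hg).mul hh)).sub (LieODE.contDiffOn_py hU hh)).add
      (LieODE.contDiffOn_px hU hg)).div (contDiffOn_const.mul hc)
      fun z hz => mul_ne_zero (by norm_num) (hc0 z hz)).congr h_d
  have D : ∀ {F : ℝ × ℝ → ℝ}, ContDiffOn ℝ ∞ F U → ∀ z ∈ U, DifferentiableAt ℝ F z :=
    fun hF z hz => LieODE.differentiableAt_of_contDiffOn hU hF hz
  refine ⟨c, g, h, d, hc, hg, hh, hd, ?_, LieODE.LieCriteria.isLieLinearizable hU hc hg hh hd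
    (hLie.elim id fun H => H.lieCriteria hU hc hg hh hd)⟩
  refine LieODE.arisesByDifferentiating_quinticRHS (D hc) (D hg) (D hh) (D hd)
    (fun z hz => ?_) (fun z hz => ?_) (fun z hz => ?_) (fun z hz => ?_) h_ε h_φ
  · linear_combination -3 * h_c z hz
  · have h1 := h_g z hz
    have h0 := hc0 z hz
    field_simp at h1
    linear_combination -h1
  · have h1 := h_h z hz
    have h0 := hc0 z hz
    field_simp at h1
    linear_combination -h1
  · have h1 := h_d z hz
    have h0 := hc0 z hz
    field_simp at h1
    linear_combination -h1
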